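/- Let $k$ be a field, let $V=k[[t]]$ with order function $\mathrm{o}(\cdot)$, and let $A=k[[t^5,t^{11}]]\subseteq V$ be the semigroup ring of $H=\langle 5,11\rangle$, i.e. the ring of all power series $\sum_{h\in H}c_ht^h$ with $c_h\in k$; it is a one-dimensional Cohen-Macaulay local ring with maximal ideal $\mathfrak m$. An $\mathfrak m$-primary ideal $I$ of $A$ is called an Ulrich ideal if it contains a parameter ideal $Q$ of $A$ such that $I\ne Q$ and $I^2=QI$, and if $I/I^2$ is a free $A/I$-module. We say that $I$ has the data $(a,b)$ if there are $f,g\in I$ with $I=(f,g)$, $I^2=fI$, $\mathrm{o}(f)=a$ and $\mathrm{o}(g)=b$. Let $I$ be an Ulrich ideal of $A$. (1) If $I$ has the data $(a,b)=(10,27)$, then $$I=(t^{10}+\alpha_1t^{11}+\alpha_2t^{16}+\alpha_3t^{22},\ t^{27})$$ for some $\alpha_1,\alpha_2,\alpha_3\in k$ with $\alpha_1\ne 0$. (2) If $I$ has the data $(a,b)=(20,26)$, then $$I=(t^{20}+\alpha_1t^{21}+\alpha_2t^{22}+\alpha_3t^{27}+\alpha_4t^{33},\ t^{26}+\beta_1t^{27}+\beta_2t^{33})\quad\text{and}\quad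 t^{32}+\varepsilon t^{33}\in I$$ for some $\alpha_1,\alpha_2,\alpha_3,\alpha_4,\beta_1,\beta_2,\varepsilon\in k$. -/

import Mathlib

open PowerSeries

/-- `k[[H]]`: the ring of the formal power series `∑_{h ∈ H} c_h t^h` over `k` with exponents in the
additive submonoid `H` of `ℕ`, as a `k`-subalgebra of `V = k[[t]]`. If `H` is generated by
`a₁, …, a_ℓ`, this is `k[[t^{a₁}, …, t^{a_ℓ}]]`. -/
def semigroupRing (k : Type*) [Field k] (H : AddSubmonoid ℕ) : Subalgebra k k⟦X⟧ where
  carrier := {f | ∀ n, PowerSeries.coeff n f ≠ 0 → n ∈ H}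
  mul_mem' := by
    intro f g hf hg n hn
    rw [PowerSeries.coeff_mul] at hn
    obtain ⟨p, hp, hne⟩ := Finset.exists_ne_zero_of_sum_ne_zero hn
    rw [← Finset.HasAntidiagonal.mem_antidiagonal.mp hp]
    exact H.add_mem (hf _ (left_ne_zero_of_mul hne)) (hg _ (right_ne_zero_of_mul hne))
  add_mem' := by
    intro f g hf hg n hn
    by_cases h : PowerSeries.coeff n f = 0
    · refine hg n fun h' => hn ?_
      rw [map_add, h, h', add_zero]
    · exact hf n h
  algebraMap_mem' := by
    intro c n hn
    rw [PowerSeries.algebraMap_apply, PowerSeries.coeff_C] at hn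
    by_cases h : n = 0
    · rw [h]
      exact H.zero_mem
    · simp [h] at hn

theorem semigroupRing_isUnit {k : Type*} [Field k] {H : AddSubmonoid ℕ} (f : semigroupRing k H)
    (hf : PowerSeries.constantCoeff (f : k⟦X⟧) ≠ 0) : IsUnit f := by
  have hmem : (f : k⟦X⟧)⁻¹ ∈ semigroupRing k H := by
    intro n
    induction n using Nat.strong_induction_on with
    | _ n ih =>
      intro hn
      rw [PowerSeries.coeff_inv] at hn
      by_cases h0 : n = 0
      · rw [h0]
        exact H.zero_mem
      rw [if_neg h0] at hn
      obtain ⟨p, hp, hne⟩ := Finset.exists_ne_zero_of_sum_ne_zero (right_ne_zero_of_mul hn)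
      by_cases hlt : p.2 < n
      · rw [if_pos hlt] at hne
        rw [← Finset.HasAntidiagonal.mem_antidiagonal.mp hp]
        exact H.add_mem (f.2 _ (left_ne_zero_of_mul hne)) (ih _ hlt (right_ne_zero_of_mul hne))
      · exact absurd (if_neg hlt) hne
  exact IsUnit.of_mul_eq_one ⟨_, hmem⟩ (Subtype.ext (PowerSeries.mul_inv_cancel _ hf))

instance semigroupRing_isLocalRing (k : Type*) [Field k] (H : AddSubmonoid ℕ) :
    IsLocalRing (semigroupRing k H) := by
  refine IsLocalRing.of_isUnit_or_isUnit_one_sub_self fun f => ?_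
  by_cases hf : PowerSeries.constantCoeff (f : k⟦X⟧) = 0
  · exact Or.inr (semigroupRing_isUnit _ (by simp [hf]))
  · exact Or.inl (semigroupRing_isUnit _ hf)

/-- A parameter ideal of a local ring `A`: an ideal that is primary to the maximal ideal and
generated by `d = dim A` elements. -/
def IsParameterIdeal {A : Type*} [CommRing A] [IsLocalRing A] (Q : Ideal A) : Prop :=
  Q.radical = IsLocalRing.maximalIdeal A ∧
    ∃ (d : ℕ) (x : Fin d → A), ringKrullDim A = d ∧ Q = Ideal.span (Set.range x)

/-- An Ulrich ideal of a (Cohen-Macaulay) local ring `A`: an ideal `I`, primary to the maximal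
ideal, containing a parameter ideal `Q` with `I ≠ Q` and `I² = QI` (so `Q` is a reduction of `I`),
and such that `I/I²` is a free `A/I`-module. -/
def IsUlrichIdeal {A : Type*} [CommRing A] [IsLocalRing A] (I : Ideal A) : Prop :=
  I.radical = IsLocalRing.maximalIdeal A ∧
    (∃ Q : Ideal A, IsParameterIdeal Q ∧ Q ≤ I ∧ I ≠ Q ∧ I ^ 2 = Q * I) ∧
    Module.Free (A ⧸ I) I.Cotangent

/-- The ideal `I` of `k[[H]]` has the data `(a, b)`: there are `f, g ∈ I` with `I = (f, g)`,
`I² = fI`, `o(f) = a` and `o(g) = b`, where `o` is the order function of `k[[t]]`. -/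
def HasData {k : Type*} [Field k] {H : AddSubmonoid ℕ} (I : Ideal (semigroupRing k H))
    (a b : ℕ) : Prop :=
  ∃ f g : semigroupRing k H, I = Ideal.span {f, g} ∧ I ^ 2 = Ideal.span {f} * I ∧
    (f : k⟦X⟧).order = a ∧ (g : k⟦X⟧).order = b

/-! Both normal forms come from knowing enough orders of elements of `I`. If `I` contains an element
of order `n`, the term in `t ^ n` can be removed modulo `I`. Since `H` contains every integer from
40 on, all high terms are multiples of `f`, so this reduction is finite (`exists_reduction`). The
generators keep only their leading term and terms at the few elements of `H` not shown to be orders.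
Replacing generators by others in `I` of the same orders does not change the ideal
(`eq_span_pair_of_order_eq`).

For the data (20, 26), `I² = fI` makes the orders minus 20 closed under addition, so 26 produces 32,
38 and 44.

For the data (10, 27), the missing order is 33, that of `t ^ 22 f - t ^ 5 g`, provided the
coefficient of `t ^ 11` in `f` is nonzero. This is where the Ulrich property enters: freeness of `I
/ I²` forces `(f) : g ⊆ I`, and a zero coefficient would put an element of order 16 into `(f) : g`
but not into `I`. -/

/-! ### Freeness of `I / I²` -/

/-- Nakayama's lemma: a generator of `I / I²` lifts to a generator of `I`. -/
theorem Ideal.eq_span_singleton_of_free_cotangent_of_finrank_le_one {A : Type*} [CommRing A]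
    [IsLocalRing A] {I : Ideal A} (hfg : I.FG) (htop : I ≠ ⊤)
    (hfree : Module.Free (A ⧸ I) I.Cotangent)
    (hrank : Module.finrank (A ⧸ I) I.Cotangent ≤ 1) : ∃ h ∈ I, I = Ideal.span {h} := by
  have : Nontrivial (A ⧸ I) := Ideal.Quotient.nontrivial_iff.mpr htop
  have : Module.Finite A I := Module.Finite.iff_fg.mpr hfg
  have : Module.Finite A I.Cotangent :=
    Module.Finite.of_surjective I.toCotangent I.toCotangent_surjective
  have : Module.Finite (A ⧸ I) I.Cotangent := Module.Finite.of_restrictScalars_finite A _ _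
  obtain ⟨v, hv⟩ := finrank_le_one_iff.mp hrank
  obtain ⟨h, rfl⟩ := I.toCotangent_surjective v
  refine ⟨h, h.2, le_antisymm ?_ ((Ideal.span_singleton_le_iff_mem _).mpr h.2)⟩
  refine Submodule.le_of_le_smul_of_le_jacobson_bot (I := I) hfg ?_ fun x hx => ?_
  · rw [IsLocalRing.jacobson_eq_maximalIdeal _ bot_ne_top]
    exact IsLocalRing.le_maximalIdeal htop
  · obtain ⟨c, hc⟩ := hv (I.toCotangent ⟨x, hx⟩)
    obtain ⟨c, rfl⟩ := Ideal.Quotient.mk_surjective c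
    have hc' : I.toCotangent ⟨x, hx⟩ = I.toCotangent (c • h) := by
      rw [← hc, map_smul]; rfl
    rw [Ideal.toCotangent_eq] at hc'
    rw [Submodule.mem_sup]
    refine ⟨c * h, Ideal.mul_mem_left _ _ (Ideal.mem_span_singleton_self _), x - c * h, ?_, by ring⟩
    rw [smul_eq_mul, ← pow_two]
    exact hc'

/-- An Ulrich ideal of a domain minimally generated by `f` and `g` contains `(f) : g`. -/
theorem IsUlrichIdeal.mem_of_mul_eq_mul {A : Type*} [CommRing A] [IsDomain A] [IsLocalRing A]
    {I : Ideal A} (hI : IsUlrichIdeal I) {f g b c : A} (hfg : I = Ideal.span {f, g}) (hf : f ≠ 0)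
    (h : b * g = c * f) : b ∈ I := by
  by_cases htop : I = ⊤
  · rw [htop]; trivial
  obtain ⟨-, ⟨Q, -, hQI, hne, hQ⟩, hfree⟩ := hI
  have hfI : f ∈ I := hfg ▸ Ideal.subset_span (by simp)
  have hgI : g ∈ I := hfg ▸ Ideal.subset_span (by simp)
  have hFG : I.FG := hfg ▸ Submodule.fg_span (Set.toFinite _)
  have hnt : Nontrivial (A ⧸ I) := Ideal.Quotient.nontrivial_iff.mpr htop
  -- In rank at most 1, `I = (p)`, and `p² ∈ I² = Q (p)` gives `p ∈ Q` by cancellation, against `I ≠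
  -- Q`.
  have hrank : 2 ≤ Module.finrank (A ⧸ I) I.Cotangent := by
    by_contra hlt
    obtain ⟨p, hpI, hp⟩ :=
      Ideal.eq_span_singleton_of_free_cotangent_of_finrank_le_one hFG htop hfree (by omega)
    have hp0 : p ≠ 0 := by
      rintro rfl
      rw [hp] at hfI
      exact hf (by simpa using hfI)
    have hpp : p * p ∈ Q * Ideal.span {p} := by
      rw [← hp, ← hQ, pow_two]
      exact Ideal.mul_mem_mul hpI hpI
    obtain ⟨q, hq, hqp⟩ := Ideal.mem_mul_span_singleton.mp hpp
    have : q = p := mul_right_cancel₀ hp0 hqp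
    exact hne (le_antisymm (hp ▸ (Ideal.span_singleton_le_iff_mem _).mpr (this ▸ hq)) hQI)
  have hspan : (⊤ : Submodule (A ⧸ I) I.Cotangent) ≤ Submodule.span (A ⧸ I)
      (Set.range ![I.toCotangent ⟨f, hfI⟩, I.toCotangent ⟨g, hgI⟩]) := by
    rintro v -
    obtain ⟨⟨x, hx⟩, rfl⟩ := I.toCotangent_surjective v
    obtain ⟨p, q, hpq⟩ := Ideal.mem_span_pair.mp (hfg ▸ hx)
    have : (⟨x, hx⟩ : I) = p • ⟨f, hfI⟩ + q • ⟨g, hgI⟩ := Subtype.ext hpq.symm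
    rw [this, map_add, map_smul, map_smul]
    refine Submodule.add_mem _ ?_ ?_
    · exact Submodule.smul_mem _ (Ideal.Quotient.mk I p)
        (Submodule.subset_span (Set.mem_range.mpr ⟨0, rfl⟩))
    · exact Submodule.smul_mem _ (Ideal.Quotient.mk I q)
        (Submodule.subset_span (Set.mem_range.mpr ⟨1, rfl⟩))
  -- Two generators of a free module of rank at least 2 form a basis, so the relation `b g - c f =
  -- 0` has its coefficients in `I`.
  have hind := linearIndependent_of_top_le_span_of_card_le_finrank hspan (by simpa using hrank)
  have := LinearIndependent.pair_iff.mp hind (Ideal.Quotient.mk I (-c)) (Ideal.Quotient.mk I b) (by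
    have h0 : -c • (⟨f, hfI⟩ : I) + b • ⟨g, hgI⟩ = 0 := Subtype.ext (by
      simp only [Submodule.coe_add, Submodule.coe_smul, smul_eq_mul, Submodule.coe_zero]
      rw [h]; ring)
    have := congrArg I.toCotangent h0
    rw [map_add, map_smul, map_smul, map_zero] at this
    exact this)
  exact Ideal.Quotient.eq_zero_iff_mem.mp this.2

/-! ### Membership in the semigroup generated by 5 and 11 -/

/-- As 11 ≡ 1 mod 5, the least element of the semigroup in the residue class `r` mod 5 is `11 r`. -/
theorem mem_closure_five_eleven {n : ℕ} :
    n ∈ AddSubmonoid.closure ({5, 11} : Set ℕ) ↔ 11 * (n % 5) ≤ n := by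
  rw [AddSubmonoid.mem_closure_pair]
  constructor
  · rintro ⟨i, j, rfl⟩
    simp only [smul_eq_mul]
    have h : (i * 5 + j * 11) % 5 = j % 5 := by omega
    have := Nat.mod_le j 5
    omega
  · intro h
    refine ⟨(n - 11 * (n % 5)) / 5, n % 5, ?_⟩
    simp only [smul_eq_mul]
    omega

/-! ### Orders and reduction in a general semigroup ring -/

namespace semigroupRing

variable {k : Type*} [Field k] {H : AddSubmonoid ℕ}

theorem coeff_eq_zero (x : semigroupRing k H) {n : ℕ} (hn : n ∉ H) :
    PowerSeries.coeff n (x : k⟦X⟧) = 0 := by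
  by_contra h
  exact hn (x.2 n h)

/-- The monomial `t ^ h` of `k[[H]]`. -/
noncomputable def tpow (k : Type*) [Field k] {H : AddSubmonoid ℕ} {h : ℕ} (hh : h ∈ H) :
    semigroupRing k H :=
  ⟨X ^ h, fun n hn => by
    rw [coeff_X_pow] at hn
    by_cases hnh : n = h
    · exact hnh ▸ hh
    · simp [hnh] at hn⟩

@[simp] theorem coe_tpow {h : ℕ} (hh : h ∈ H) : (tpow k hh : k⟦X⟧) = X ^ h := rfl

/-- `I` contains a power series with initial term `t ^ n`. -/
def HasLead (I : Ideal (semigroupRing k H)) (n : ℕ) : Prop :=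
  ∃ x ∈ I, PowerSeries.coeff n (x : k⟦X⟧) = 1 ∧ ∀ m < n, PowerSeries.coeff m (x : k⟦X⟧) = 0

theorem hasLead_of_order_eq {I : Ideal (semigroupRing k H)} {x : semigroupRing k H} (hx : x ∈ I)
    {n : ℕ} (hn : (x : k⟦X⟧).order = n) : HasLead I n := by
  obtain ⟨h1, h2⟩ := order_eq_nat.mp hn
  exact ⟨(PowerSeries.coeff n (x : k⟦X⟧))⁻¹ • x, Submodule.smul_of_tower_mem I _ hx,
    by simp [h1], fun m hm => by simp [h2 m hm]⟩

theorem order_eq_of_lead {x : k⟦X⟧} {n : ℕ} (h1 : PowerSeries.coeff n x = 1)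
    (h2 : ∀ m < n, PowerSeries.coeff m x = 0) : x.order = n :=
  order_eq_nat.mpr ⟨by simp [h1], h2⟩

theorem HasLead.add {I : Ideal (semigroupRing k H)} {n h : ℕ} (hn : HasLead I n) (hh : h ∈ H) :
    HasLead I (n + h) := by
  obtain ⟨x, hx, h1, h2⟩ := hn
  refine hasLead_of_order_eq (x := x * tpow k hh) (I.mul_mem_right _ hx) ?_
  simp [order_mul, order_eq_of_lead h1 h2]

/-- If `I ^ 2 = f I`, then the orders of the elements of `I / f` form a semigroup. -/
theorem HasLead.mul_div {I : Ideal (semigroupRing k H)} {f : semigroupRing k H} {a m n l : ℕ}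
    (hI : I ^ 2 = Ideal.span {f} * I) (hf : (f : k⟦X⟧).order = a) (hm : HasLead I m)
    (hn : HasLead I n) (hl : a + l = m + n) : HasLead I l := by
  obtain ⟨x, hx, h1, h2⟩ := hm
  obtain ⟨y, hy, h3, h4⟩ := hn
  have hxy : x * y ∈ Ideal.span {f} * I := by
    rw [← hI, pow_two]
    exact Ideal.mul_mem_mul hx hy
  obtain ⟨z, hz, hfz⟩ := Ideal.mem_span_singleton_mul.mp hxy
  refine hasLead_of_order_eq hz ?_
  have := congrArg (fun w : semigroupRing k H => (w : k⟦X⟧).order) hfz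
  simp only [MulMemClass.coe_mul, order_mul, hf, order_eq_of_lead h1 h2,
    order_eq_of_lead h3 h4] at this
  have h5 : (z : k⟦X⟧).order ≠ ⊤ := by
    intro h
    rw [h] at this
    simp at this
    exact absurd this.symm (by exact_mod_cast ENat.natCast_ne_top (m + n))
  obtain ⟨o, ho⟩ := ENat.ne_top_iff_exists.mp h5
  rw [← ho] at this ⊢
  norm_cast at this ⊢
  omega

theorem coeff_mul_of_order_eq {p : k⟦X⟧} {n : ℕ} (hp : p.order = n) (r : k⟦X⟧) :
    PowerSeries.coeff n (r * p) = constantCoeff r * PowerSeries.coeff n p := by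
  obtain ⟨u, hu⟩ := X_pow_order_dvd (φ := p)
  rw [hp, ENat.toNat_natCast] at hu
  have (q : k⟦X⟧) : PowerSeries.coeff n (X ^ n * q) = constantCoeff q := by
    rw [coeff_X_pow_mul', if_pos le_rfl, Nat.sub_self, coeff_zero_eq_constantCoeff]
  rw [hu, mul_left_comm, this, this, map_mul]

theorem coeff_mul_of_lt_order {p : k⟦X⟧} {n m : ℕ} (hp : p.order = n) (hm : m < n) (r : k⟦X⟧) :
    PowerSeries.coeff m (r * p) = 0 := by
  refine coeff_of_lt_order _ ?_
  rw [order_mul, hp]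
  exact lt_of_lt_of_le (by exact_mod_cast hm) le_add_self

/-- The quotient in `k[[t]]` has order at least `N`, so all its exponents lie in `H`. -/
theorem dvd_of_order {N a : ℕ} (hH : ∀ n, N ≤ n → n ∈ H) {f x : semigroupRing k H}
    (hf : (f : k⟦X⟧).order = a) (hx : ∀ m < a + N, PowerSeries.coeff m (x : k⟦X⟧) = 0) :
    f ∣ x := by
  obtain ⟨y, hy⟩ := X_pow_dvd_iff.mpr hx
  obtain ⟨u, hu⟩ := X_pow_order_dvd (φ := (f : k⟦X⟧))
  rw [hf] at hu
  simp only [ENat.toNat_natCast] at hu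
  have hu0 : constantCoeff u ≠ 0 := by
    have := (order_eq_nat.mp hf).1
    rw [hu, coeff_X_pow_mul', if_pos le_rfl, Nat.sub_self] at this
    simpa using this
  refine ⟨⟨X ^ N * (u⁻¹ * y), fun n hn => ?_⟩, Subtype.ext ?_⟩
  · refine hH n ?_
    by_contra hlt
    exact hn (by rw [coeff_X_pow_mul', if_neg hlt])
  · simp only [MulMemClass.coe_mul]
    rw [hy, hu]
    calc X ^ (a + N) * y = X ^ a * X ^ N * (u * u⁻¹) * y := by
          rw [PowerSeries.mul_inv_cancel _ hu0]; ring
      _ = _ := by ring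

/-- Reduction modulo `I`: above degree `m`, the terms whose degrees are orders of elements of `I`
can be removed. -/
theorem exists_reduction {N a : ℕ} (hH : ∀ n, N ≤ n → n ∈ H) {I : Ideal (semigroupRing k H)}
    {f : semigroupRing k H} (hfI : f ∈ I) (hf : (f : k⟦X⟧).order = a) (m : ℕ)
    (x : semigroupRing k H) :
    ∃ y : semigroupRing k H, x - y ∈ I ∧
      (∀ n < m, PowerSeries.coeff n (y : k⟦X⟧) = PowerSeries.coeff n (x : k⟦X⟧)) ∧
      ∀ n, m ≤ n → HasLead I n → PowerSeries.coeff n (y : k⟦X⟧) = 0 := by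
  -- Once `m` reaches `a + N`, truncation below degree `m` suffices, because the discarded tail is a
  -- multiple of `f`. Below that bound, at most one term is removed for each degree.
  by_cases hm : a + N ≤ m
  · refine ⟨⟨(trunc m (x : k⟦X⟧) : Polynomial k), fun n hn => ?_⟩, ?_, fun n hn => ?_,
      fun n hn _ => ?_⟩
    · rw [Polynomial.coeff_coe, coeff_trunc] at hn
      exact x.2 n (by split_ifs at hn with h; exacts [hn, absurd rfl hn])
    · refine I.mem_of_dvd (dvd_of_order hH hf fun n hn => ?_) hfI
      simp [coeff_trunc, hn.trans_le hm]
    · simp [coeff_trunc, hn]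
    · simp [coeff_trunc, hn.not_gt]
  · by_cases hI : HasLead I m
    · obtain ⟨e, he, h1, h2⟩ := hI
      obtain ⟨y, hy1, hy2, hy3⟩ := exists_reduction hH hfI hf (m + 1)
        (x - PowerSeries.coeff m (x : k⟦X⟧) • e)
      refine ⟨y, ?_, fun n hn => ?_, fun n hn hl => ?_⟩
      · have := I.add_mem hy1
          (Submodule.smul_of_tower_mem I (PowerSeries.coeff m (x : k⟦X⟧)) he)
        rwa [sub_right_comm, sub_add_cancel] at this
      · rw [hy2 n (by omega)]
        simp [h2 n hn]
      · rcases hn.eq_or_lt with rfl | hlt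
        · rw [hy2 m (by omega)]
          simp [h1]
        · exact hy3 n hlt hl
    · obtain ⟨y, hy1, hy2, hy3⟩ := exists_reduction hH hfI hf (m + 1) x
      refine ⟨y, hy1, fun n hn => hy2 n (by omega), fun n hn hl => ?_⟩
      rcases hn.eq_or_lt with rfl | hlt
      · exact absurd hl hI
      · exact hy3 n hlt hl
termination_by a + N - m

/-- Generators of a two-generated ideal may be replaced by elements with the same orders. -/
theorem eq_span_pair_of_order_eq {I : Ideal (semigroupRing k H)} {f g f' g' : semigroupRing k H}
    {a b : ℕ} (hI : I = Ideal.span {f, g}) (hab : a < b) (hH : b - a ∉ H)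
    (hf : (f : k⟦X⟧).order = a) (hg : (g : k⟦X⟧).order = b) (hf' : (f' : k⟦X⟧).order = a)
    (hg' : (g' : k⟦X⟧).order = b) (hfI : f' ∈ I) (hgI : g' ∈ I) : I = Ideal.span {f', g'} := by
  refine le_antisymm ?_ (Ideal.span_le.mpr (by rintro _ (rfl | rfl) <;> assumption))
  obtain ⟨x, y, hxy⟩ := Ideal.mem_span_pair.mp (hI ▸ hfI)
  obtain ⟨u, w, huw⟩ := Ideal.mem_span_pair.mp (hI ▸ hgI)
  have hxy' := congrArg (fun z : semigroupRing k H => (z : k⟦X⟧)) hxy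
  have huw' := congrArg (fun z : semigroupRing k H => (z : k⟦X⟧)) huw
  simp only [AddMemClass.coe_add, MulMemClass.coe_mul] at hxy' huw'
  have hx0 : constantCoeff (x : k⟦X⟧) ≠ 0 := by
    intro h
    refine (order_eq_nat.mp hf').1 ?_
    rw [← hxy', map_add, coeff_mul_of_order_eq hf, coeff_mul_of_lt_order hg hab, h]
    simp
  have hu0 : constantCoeff (u : k⟦X⟧) = 0 := by
    have := (order_eq_nat.mp hg').2 a hab
    rw [← huw', map_add, coeff_mul_of_order_eq hf, coeff_mul_of_lt_order hg hab, add_zero] at this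
    exact (mul_eq_zero.mp this).resolve_right (order_eq_nat.mp hf).1
  -- If `w` had no constant term, `u f` alone would account for the order `b` of `g'`, and `u` would
  -- have order `b - a`, which is not in `H`. Hence the transition matrix is invertible.
  have hw0 : constantCoeff (w : k⟦X⟧) ≠ 0 := by
    intro h
    have huf : ((u : k⟦X⟧) * f).order = b := by
      rw [eq_sub_of_add_eq huw', order_eq_nat]
      refine ⟨?_, fun m hm => ?_⟩
      · rw [map_sub, coeff_mul_of_order_eq hg, h, zero_mul, sub_zero]
        exact (order_eq_nat.mp hg').1
      · rw [map_sub, coeff_mul_of_lt_order hg hm, (order_eq_nat.mp hg').2 m hm, sub_zero]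
    rw [order_mul, hf] at huf
    have hu : (u : k⟦X⟧).order ≠ ⊤ := by
      intro h
      rw [h, top_add] at huf
      exact ENat.natCast_ne_top b huf.symm
    obtain ⟨o, ho⟩ := ENat.ne_top_iff_exists.mp hu
    rw [← ho] at huf
    norm_cast at huf
    exact hH ((by omega : b - a = o) ▸ u.2 o (order_eq_nat.mp ho.symm).1)
  have hdet : IsUnit (x * w - y * u) := semigroupRing_isUnit _ (by simp [hx0, hu0, hw0])
  rw [hI, Ideal.span_le]
  rintro z (rfl | rfl)
  · refine (Ideal.unit_mul_mem_iff_mem _ hdet).mp (Ideal.mem_span_pair.mpr ⟨w, -y, ?_⟩)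
    rw [← hxy, ← huw]; ring
  · refine (Ideal.unit_mul_mem_iff_mem _ hdet).mp (Ideal.mem_span_pair.mpr ⟨-u, x, ?_⟩)
    rw [← hxy, ← huw]; ring

end semigroupRing

/-! ### Ideals of `k[[t^5, t^11]]` -/

namespace semigroupRing

variable {k : Type*} [Field k]

theorem mem_five_eleven_of_forty_le (n : ℕ) (hn : 40 ≤ n) :
    n ∈ AddSubmonoid.closure ({5, 11} : Set ℕ) := by
  rw [mem_closure_five_eleven]
  omega

theorem coeff_eq_zero_of_mod (x : semigroupRing k (AddSubmonoid.closure {5, 11})) {n : ℕ}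
    (hn : n < 11 * (n % 5)) : PowerSeries.coeff n (x : k⟦X⟧) = 0 :=
  coeff_eq_zero x (by rw [mem_closure_five_eleven]; omega)

theorem HasLead.of_le {I : Ideal (semigroupRing k (AddSubmonoid.closure {5, 11}))} {m n : ℕ}
    (hm : HasLead I m) (hmn : m ≤ n) (h : 11 * ((n - m) % 5) ≤ n - m) : HasLead I n := by
  rw [← Nat.add_sub_cancel' hmn]
  exact hm.add (mem_closure_five_eleven.mpr h)

/-- The second coefficient of the generator of order `10` is a unit: otherwise `(f) : g` would
contain an element of order `16`, while `I` does not. -/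
theorem coeff_eleven_ne_zero {I : Ideal (semigroupRing k (AddSubmonoid.closure {5, 11}))}
    (hI : IsUlrichIdeal I) {f g : semigroupRing k (AddSubmonoid.closure {5, 11})}
    (hfg : I = Ideal.span {f, g}) (hf : PowerSeries.coeff 10 (f : k⟦X⟧) = 1)
    (hf' : ∀ m < 10, PowerSeries.coeff m (f : k⟦X⟧) = 0)
    (hg : PowerSeries.coeff 27 (g : k⟦X⟧) = 1)
    (hg' : ∀ m < 27, PowerSeries.coeff m (g : k⟦X⟧) = 0) :
    PowerSeries.coeff 11 (f : k⟦X⟧) ≠ 0 := by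
  intro h11
  have hH (n : ℕ) (h : 11 * (n % 5) ≤ n) := mem_closure_five_eleven.mpr h
  -- The coefficients of `b` and `c` are solved degree by degree so that `b g` and `c f` agree in
  -- all degrees below 50 = 10 + 40. The difference is then a multiple of `f`, and adding the
  -- quotient to `c` gives an exact relation.
  let b : semigroupRing k (AddSubmonoid.closure {5, 11}) := tpow k (hH 16 (by norm_num)) +
    (PowerSeries.coeff 16 (f : k⟦X⟧) - PowerSeries.coeff 33 (g : k⟦X⟧)) •
      tpow k (hH 22 (by norm_num))
  let c : semigroupRing k (AddSubmonoid.closure {5, 11}) := tpow k (hH 33 (by norm_num)) +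
    PowerSeries.coeff 30 (g : k⟦X⟧) • tpow k (hH 36 (by norm_num)) +
    PowerSeries.coeff 31 (g : k⟦X⟧) • tpow k (hH 37 (by norm_num)) +
    (PowerSeries.coeff 32 (g : k⟦X⟧) - PowerSeries.coeff 15 (f : k⟦X⟧)) •
      tpow k (hH 38 (by norm_num))
  have hforder : (f : k⟦X⟧).order = 10 := by exact_mod_cast order_eq_of_lead hf hf'
  have hdvd : f ∣ b * g - c * f := by
    refine dvd_of_order mem_five_eleven_of_forty_le (a := 10) hforder fun m hm => ?_
    have e (n : ℕ) (h : n < 11 * (n % 5)) := coeff_eq_zero_of_mod f h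
    have e' (n : ℕ) (h : n < 11 * (n % 5)) := coeff_eq_zero_of_mod g h
    simp only [b, c, Subalgebra.coe_sub, MulMemClass.coe_mul, AddMemClass.coe_add,
      Subalgebra.coe_smul, coe_tpow, add_mul, smul_mul_assoc, map_sub, map_add, coeff_smul,
      coeff_X_pow_mul', smul_eq_mul]
    by_cases hm' : m < 43
    · rw [hg' (m - 16) (by omega), hg' (m - 22) (by omega), hf' (m - 33) (by omega),
        hf' (m - 36) (by omega), hf' (m - 37) (by omega), hf' (m - 38) (by omega)]
      simp
    · interval_cases m <;>
        simp [hf, hf', hg, hg', h11, e 12, e 13, e 14, e' 28, e' 29]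
  obtain ⟨q, hq⟩ := hdvd
  have hf0 : f ≠ 0 := by
    rintro rfl
    simp at hf
  have hb := hI.mem_of_mul_eq_mul (b := b) (c := c + q) hfg hf0
    (by linear_combination hq)
  rw [hfg] at hb
  obtain ⟨p, r, hpr⟩ := Ideal.mem_span_pair.mp hb
  obtain ⟨f₀, hf₀⟩ := X_pow_dvd_iff.mpr hf'
  obtain ⟨g₀, hg₀⟩ := X_pow_dvd_iff.mpr hg'
  have hpr' := congrArg (fun z : semigroupRing k _ => (z : k⟦X⟧)) hpr
  simp only [b, AddMemClass.coe_add, MulMemClass.coe_mul, Subalgebra.coe_smul, coe_tpow] at hpr'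
  have hc (n : ℕ) := congrArg (PowerSeries.coeff n) hpr'
  have hF (n : ℕ) : PowerSeries.coeff n f₀ = PowerSeries.coeff (n + 10) (f : k⟦X⟧) := by
    rw [hf₀, coeff_X_pow_mul]
  have hr (n : ℕ) (hn : n < 27) : PowerSeries.coeff n ((r : k⟦X⟧) * (g : k⟦X⟧)) = 0 := by
    rw [hg₀, mul_left_comm, coeff_X_pow_mul', if_neg (by omega)]
  have hp (n : ℕ) : PowerSeries.coeff (n + 10) ((p : k⟦X⟧) * (f : k⟦X⟧)) =
      PowerSeries.coeff n ((p : k⟦X⟧) * f₀) := by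
    rw [hf₀, mul_left_comm, coeff_X_pow_mul]
  have e (n : ℕ) (h : n < 11 * (n % 5)) := coeff_eq_zero_of_mod p h
  -- In `b = p f + r g` the term `r g` starts in degree 27, so degrees 10, 15 and 16 only see `p f`.
  -- Degree 10 kills the constant term of `p`. In degree 16 nothing is then left, since 6 is not in
  -- `H` and `f` has no term in `t ^ 11`, whereas `b` has coefficient 1 there.
  have c0 := hc (0 + 10)
  have c5 := hc (5 + 10)
  have c6 := hc (6 + 10)
  rw [map_add, hp, hr _ (by norm_num), add_zero, coeff_mul] at c0 c5 c6
  simp only [Finset.Nat.antidiagonal_succ, Finset.Nat.antidiagonal_zero, Finset.map_singleton,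
    Finset.sum_cons, Finset.map_cons, Finset.sum_singleton, Function.Embedding.prodMap,
    Function.Embedding.coeFn_mk, Prod.map, Nat.succ_eq_add_one, hF] at c0 c5 c6
  simp [hf, h11, e 1, e 2, e 3, e 4, e 6, coeff_X_pow] at c0 c5 c6
  simp [c0] at c5 c6

theorem hasData_ten_twentySeven {I : Ideal (semigroupRing k (AddSubmonoid.closure {5, 11}))}
    (hI : IsUlrichIdeal I) (h : HasData I 10 27) :
    ∃ α₁ α₂ α₃ : k, α₁ ≠ 0 ∧
      ∃ f g : semigroupRing k (AddSubmonoid.closure {5, 11}),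
        (f : k⟦X⟧) = X ^ 10 + C α₁ * X ^ 11 + C α₂ * X ^ 16 + C α₃ * X ^ 22 ∧
        (g : k⟦X⟧) = X ^ 27 ∧ I = Ideal.span {f, g} := by
  obtain ⟨f₀, g₀, hfg₀, -, hf₀, hg₀⟩ := h
  have hf₀I : f₀ ∈ I := hfg₀ ▸ Ideal.subset_span (by simp)
  have hg₀I : g₀ ∈ I := hfg₀ ▸ Ideal.subset_span (by simp)
  have hgen {f g} (hf : f ∈ I) (hg : g ∈ I) (hf' : (f : k⟦X⟧).order = (10 : ℕ))
      (hg' : (g : k⟦X⟧).order = (27 : ℕ)) : I = Ideal.span {f, g} :=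
    eq_span_pair_of_order_eq hfg₀ (by norm_num) (by rw [mem_closure_five_eleven]; norm_num)
      hf₀ hg₀ hf' hg' hf hg
  have l10 : HasLead I 10 := hasLead_of_order_eq hf₀I hf₀
  have l27 : HasLead I 27 := hasLead_of_order_eq hg₀I hg₀
  obtain ⟨f, hf, hf1, hf2⟩ := l10
  obtain ⟨g, hg, hg1, hg2⟩ := l27
  have hH (n : ℕ) (h : 11 * (n % 5) ≤ n) := mem_closure_five_eleven.mpr h
  -- The terms in `t ^ 32` cancel. The coefficient of `t ^ 33` is that of `t ^ 11` in `f`, because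
  -- 28 is not in `H`.
  have l33 : HasLead I 33 := by
    refine hasLead_of_order_eq
      (x := tpow k (hH 22 (by norm_num)) * f - tpow k (hH 5 (by norm_num)) * g)
      (I.sub_mem (I.mul_mem_left _ hf) (I.mul_mem_left _ hg)) (order_eq_nat.mpr ?_)
    simp only [Subalgebra.coe_sub, MulMemClass.coe_mul, coe_tpow, map_sub, coeff_X_pow_mul']
    refine ⟨?_, fun m hm => ?_⟩
    · simpa [coeff_eq_zero_of_mod g (n := 28)] using coeff_eleven_ne_zero hI
        (hgen hf hg (order_eq_of_lead hf1 hf2) (order_eq_of_lead hg1 hg2)) hf1 hf2 hg1 hg2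
    · by_cases hm' : m < 32
      · rw [hf2 _ (by omega), hg2 _ (by omega)]
        simp
      · obtain rfl : m = 32 := by omega
        simp [hf1, hg1]
  -- The translates of `H` by 10, 27 and 33 cover all elements of `H` above 10 except 11, 16 and 22,
  -- as is checked in each residue class mod 5.
  have hlead (n : ℕ) (h11 : 11 ≤ n) (hn : 11 * (n % 5) ≤ n) (h : n ≠ 11 ∧ n ≠ 16 ∧ n ≠ 22) :
      HasLead I n := by
    have : (10 ≤ n ∧ 11 * ((n - 10) % 5) ≤ n - 10) ∨ (27 ≤ n ∧ 11 * ((n - 27) % 5) ≤ n - 27) ∨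
      (33 ≤ n ∧ 11 * ((n - 33) % 5) ≤ n - 33) := by
      have h5 : n % 5 < 5 := Nat.mod_lt n (by norm_num)
      interval_cases hr : n % 5 <;> omega
    rcases this with h | h | h
    · exact HasLead.of_le ⟨f, hf, hf1, hf2⟩ h.1 h.2
    · exact HasLead.of_le ⟨g, hg, hg1, hg2⟩ h.1 h.2
    · exact l33.of_le h.1 h.2
  -- Each reduction starts one degree past the order, so the leading term survives.
  obtain ⟨f', hf'I, hf'1, hf'2⟩ :=
    exists_reduction mem_five_eleven_of_forty_le hf₀I hf₀ 11 f
  obtain ⟨g', hg'I, hg'1, hg'2⟩ :=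
    exists_reduction mem_five_eleven_of_forty_le hf₀I hf₀ 28 g
  have hf' : f' ∈ I := (I.sub_mem_iff_right hf).mp hf'I
  have hg' : g' ∈ I := (I.sub_mem_iff_right hg).mp hg'I
  have f1 : PowerSeries.coeff 10 (f' : k⟦X⟧) = 1 := by rw [hf'1 10 (by norm_num), hf1]
  have f2 (m : ℕ) (hm : m < 10) : PowerSeries.coeff m (f' : k⟦X⟧) = 0 := by
    rw [hf'1 m (by omega), hf2 m hm]
  have g1 : PowerSeries.coeff 27 (g' : k⟦X⟧) = 1 := by rw [hg'1 27 (by norm_num), hg1]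
  have g2 (m : ℕ) (hm : m < 27) : PowerSeries.coeff m (g' : k⟦X⟧) = 0 := by
    rw [hg'1 m (by omega), hg2 m hm]
  have hspan := hgen hf' hg' (order_eq_of_lead f1 f2) (order_eq_of_lead g1 g2)
  refine ⟨_, PowerSeries.coeff 16 (f' : k⟦X⟧), PowerSeries.coeff 22 (f' : k⟦X⟧),
    coeff_eleven_ne_zero hI hspan f1 f2 g1 g2, f', g', ?_, ?_, hspan⟩
  · ext n
    simp only [map_add, coeff_C_mul, coeff_X_pow]
    by_cases hn : n = 10 ∨ n = 11 ∨ n = 16 ∨ n = 22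
    · rcases hn with rfl | rfl | rfl | rfl <;> simp [f1]
    · push Not at hn
      have : PowerSeries.coeff n (f' : k⟦X⟧) = 0 := by
        by_cases hmod : 11 * (n % 5) ≤ n
        · by_cases h11 : 11 ≤ n
          · exact hf'2 n h11 (hlead n h11 hmod hn.2)
          · exact f2 n (by omega)
        · exact coeff_eq_zero_of_mod _ (by omega)
      simp [this, hn]
  · ext n
    rw [coeff_X_pow]
    by_cases hn : n = 27
    · rw [hn, g1, if_pos rfl]
    · rw [if_neg hn]
      by_cases hmod : 11 * (n % 5) ≤ n
      · by_cases h28 : 28 ≤ n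
        · exact hg'2 n h28 (hlead n (by omega) hmod (by omega))
        · exact g2 n (by omega)
      · exact coeff_eq_zero_of_mod _ (by omega)

theorem hasData_twenty_twentySix {I : Ideal (semigroupRing k (AddSubmonoid.closure {5, 11}))}
    (h : HasData I 20 26) :
    ∃ α₁ α₂ α₃ α₄ β₁ β₂ ε : k,
      ∃ f g h : semigroupRing k (AddSubmonoid.closure {5, 11}),
        (f : k⟦X⟧) =
          X ^ 20 + C α₁ * X ^ 21 + C α₂ * X ^ 22 + C α₃ * X ^ 27 + C α₄ * X ^ 33 ∧
        (g : k⟦X⟧) = X ^ 26 + C β₁ * X ^ 27 + C β₂ * X ^ 33 ∧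
        I = Ideal.span {f, g} ∧
        (h : k⟦X⟧) = X ^ 32 + C ε * X ^ 33 ∧ h ∈ I := by
  obtain ⟨f₀, g₀, hfg₀, hsq, hf₀, hg₀⟩ := h
  have hf₀I : f₀ ∈ I := hfg₀ ▸ Ideal.subset_span (by simp)
  have hg₀I : g₀ ∈ I := hfg₀ ▸ Ideal.subset_span (by simp)
  have l20 : HasLead I 20 := hasLead_of_order_eq hf₀I hf₀
  have l26 : HasLead I 26 := hasLead_of_order_eq hg₀I hg₀
  -- Dividing by `f` a product with an element of order 26 raises the order by 26 - 20 = 6.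
  have l32 : HasLead I 32 := l26.mul_div hsq hf₀ l26 rfl
  have l38 : HasLead I 38 := l32.mul_div hsq hf₀ l26 rfl
  have l44 : HasLead I 44 := l38.mul_div hsq hf₀ l26 rfl
  -- The numbers 20, 26, 32, 38 and 44 represent the five residue classes mod 5; the elements of `H`
  -- from 20 on that lie below the representative of their class are 21, 22, 27 and 33.
  have hlead (n : ℕ) (h20 : 20 ≤ n) (hn : 11 * (n % 5) ≤ n)
      (h : n ≠ 21 ∧ n ≠ 22 ∧ n ≠ 27 ∧ n ≠ 33) : HasLead I n := by
    have : (20 ≤ n ∧ 11 * ((n - 20) % 5) ≤ n - 20) ∨ (26 ≤ n ∧ 11 * ((n - 26) % 5) ≤ n - 26) ∨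
      (32 ≤ n ∧ 11 * ((n - 32) % 5) ≤ n - 32) ∨ (38 ≤ n ∧ 11 * ((n - 38) % 5) ≤ n - 38) ∨
      (44 ≤ n ∧ 11 * ((n - 44) % 5) ≤ n - 44) := by
      have h5 : n % 5 < 5 := Nat.mod_lt n (by norm_num)
      interval_cases hr : n % 5 <;> omega
    rcases this with h | h | h | h | h
    · exact l20.of_le h.1 h.2
    · exact l26.of_le h.1 h.2
    · exact l32.of_le h.1 h.2
    · exact l38.of_le h.1 h.2
    · exact l44.of_le h.1 h.2
  have key (a : ℕ) (ha : 20 ≤ a) (hl : HasLead I a) : ∃ f ∈ I,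
      PowerSeries.coeff a (f : k⟦X⟧) = 1 ∧ (∀ m < a, PowerSeries.coeff m (f : k⟦X⟧) = 0) ∧
      ∀ n, n ≠ a → n ≠ 21 ∧ n ≠ 22 ∧ n ≠ 27 ∧ n ≠ 33 →
        PowerSeries.coeff n (f : k⟦X⟧) = 0 := by
    obtain ⟨f, hf, hf1, hf2⟩ := hl
    obtain ⟨f', hf'I, hf'1, hf'2⟩ :=
      exists_reduction mem_five_eleven_of_forty_le hf₀I hf₀ (a + 1) f
    have f2 (m : ℕ) (hm : m < a) : PowerSeries.coeff m (f' : k⟦X⟧) = 0 := by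
      rw [hf'1 m (by omega), hf2 m hm]
    refine ⟨f', (I.sub_mem_iff_right hf).mp hf'I, by rw [hf'1 a (by omega), hf1], f2,
      fun n hna hn => ?_⟩
    by_cases hmod : 11 * (n % 5) ≤ n
    · by_cases han : a ≤ n
      · exact hf'2 n (by omega) (hlead n (by omega) hmod hn)
      · exact f2 n (by omega)
    · exact coeff_eq_zero_of_mod _ (by omega)
  obtain ⟨f, hf, f1, f2, f3⟩ := key 20 (by norm_num) l20
  obtain ⟨g, hg, g1, g2, g3⟩ := key 26 (by norm_num) l26
  obtain ⟨h, hh, h1, h2, h3⟩ := key 32 (by norm_num) l32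
  refine ⟨PowerSeries.coeff 21 (f : k⟦X⟧), PowerSeries.coeff 22 (f : k⟦X⟧),
    PowerSeries.coeff 27 (f : k⟦X⟧), PowerSeries.coeff 33 (f : k⟦X⟧),
    PowerSeries.coeff 27 (g : k⟦X⟧), PowerSeries.coeff 33 (g : k⟦X⟧),
    PowerSeries.coeff 33 (h : k⟦X⟧), f, g, h, ?_, ?_,
    eq_span_pair_of_order_eq hfg₀ (by norm_num) (by rw [mem_closure_five_eleven]; norm_num)
      hf₀ hg₀ (order_eq_of_lead f1 f2) (order_eq_of_lead g1 g2) hf hg, ?_, hh⟩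
  · ext n
    simp only [map_add, coeff_C_mul, coeff_X_pow]
    by_cases hn : n = 20 ∨ n = 21 ∨ n = 22 ∨ n = 27 ∨ n = 33
    · rcases hn with rfl | rfl | rfl | rfl | rfl <;> simp [f1]
    · push Not at hn
      simp [f3 n hn.1 hn.2, hn]
  · ext n
    simp only [map_add, coeff_C_mul, coeff_X_pow]
    -- The reduction says nothing about degrees 21 and 22, but they lie below the order of `g`.
    by_cases hn : n = 21 ∨ n = 22 ∨ n = 26 ∨ n = 27 ∨ n = 33
    · rcases hn with rfl | rfl | rfl | rfl | rfl <;> simp [g1, g2]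
    · push Not at hn
      simp [g3 n (by omega) (by omega), hn]
  · ext n
    simp only [map_add, coeff_C_mul, coeff_X_pow]
    by_cases hn : n = 21 ∨ n = 22 ∨ n = 27 ∨ n = 32 ∨ n = 33
    · rcases hn with rfl | rfl | rfl | rfl | rfl <;> simp [h1, h2]
    · push Not at hn
      simp [h3 n (by omega) (by omega), hn]

end semigroupRing

theorem mainTheorem10 (k : Type*) [Field k]
    (I : Ideal (semigroupRing k (AddSubmonoid.closure {5, 11}))) (hI : IsUlrichIdeal I) :
    (HasData I 10 27 →
      ∃ α₁ α₂ α₃ : k, α₁ ≠ 0 ∧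
        ∃ f g : semigroupRing k (AddSubmonoid.closure {5, 11}),
          (f : k⟦X⟧) = X ^ 10 + C α₁ * X ^ 11 + C α₂ * X ^ 16 + C α₃ * X ^ 22 ∧
          (g : k⟦X⟧) = X ^ 27 ∧
          I = Ideal.span {f, g}) ∧
    (HasData I 20 26 →
      ∃ α₁ α₂ α₃ α₄ β₁ β₂ ε : k,
        ∃ f g h : semigroupRing k (AddSubmonoid.closure {5, 11}),
          (f : k⟦X⟧) =
            X ^ 20 + C α₁ * X ^ 21 + C α₂ * X ^ 22 + C α₃ * X ^ 27 + C α₄ * X ^ 33 ∧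
          (g : k⟦X⟧) = X ^ 26 + C β₁ * X ^ 27 + C β₂ * X ^ 33 ∧
          I = Ideal.span {f, g} ∧
          (h : k⟦X⟧) = X ^ 32 + C ε * X ^ 33 ∧ h ∈ I) :=
  ⟨semigroupRing.hasData_ten_twentySeven hI, semigroupRing.hasData_twenty_twentySix⟩
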